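/- Let $a,b,c,r,s,t\in\mathbb Z$, and let $$q(x,y,z)=ax^2+by^2+cz^2+2ryz+2sxz+2txy$$ be a positive definite ternary quadratic form which is Eisenstein reduced. That is, with $\epsilon=a+b+2r+2s+2t$, the following hold: 1. $r,s,t$ are all positive or all non-positive; 2. $a\le b\le c$ and $\epsilon\ge 0$; 3. $a\ge|2s|$, $a\ge|2t|$, $b\ge|2r|$; 4. if $a=b$ then $|r|\le|s|$; if $b=c$ then $|s|\le|t|$; if $\epsilon=0$ then $a+2s+t\le 0$; 5. if $a=-2t$ then $s=0$; if $a=-2s$ then $t=0$; if $b=-2r$ then $t=0$; 6. if $a=2t$ then $s\le 2r$; if $a=2s$ then $t\le 2r$; if $b=2r$ then $t\le 2s$. Let $\operatorname{Aut}^+(q)=\{g\in \mathrm{GL}_3(\mathbb Z): q(gv)=q(v)\text{ for all }v\in\mathbb Z^3,\ \det g=1\}$ and $u=|\operatorname{Aut}^+(q)|$. If $3\mid u$, then $u\in\{6,12,24\}$, and moreover: (i) $u=6$ if and only if one of the following holds: - $a=b=c$ and $r=s=t\ne 0$, where in addition $a\neq 2r$ if $r>0$, and both $a\ne -3s$ and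 $a\neq -2r$ if $r<0$; - $a=b=2r=2s=2t$ and $b\ne c$; - $b=c$, $s=t$, $2r+s=-b$, $a=-3s$ and $a\ne b$. (ii) $u=12$ if and only if either $a=b=-2t$ and $r=s=0$, or $a\ne b$, $b=c=-2r$ and $s=t=0$. (iii) $u=24$ if and only if either $a=b=c=\kappa r=\kappa s=\kappa t$ for some $\kappa\in\{2,-3\}$, or $a=b=c$ and $r=s=t=0$. -/

import Mathlib

open scoped Matrix

namespace TernaryForm

/-- The integral ternary quadratic form
`q(x, y, z) = a x² + b y² + c z² + 2 r y z + 2 s x z + 2 t x y`. -/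
def form (a b c r s t : ℤ) : QuadraticForm ℤ (Fin 3 → ℤ) :=
  Matrix.toQuadraticForm' !![a, t, s; t, b, r; s, r, c]

theorem form_apply (a b c r s t : ℤ) (v : Fin 3 → ℤ) :
    form a b c r s t v =
      a * v 0 ^ 2 + b * v 1 ^ 2 + c * v 2 ^ 2
        + 2 * r * v 1 * v 2 + 2 * s * v 0 * v 2 + 2 * t * v 0 * v 1 := by
  simp [form, Matrix.toQuadraticForm', LinearMap.BilinMap.toQuadraticMap_apply,
    Matrix.toLinearMap₂'_apply, Fin.sum_univ_three]
  ring

/-- The group of automorphs of `q`: all `g ∈ GL₃(ℤ)` with `q (g v) = q v` for all `v ∈ ℤ³`. -/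
def Aut (q : QuadraticForm ℤ (Fin 3 → ℤ)) : Subgroup (GL (Fin 3) ℤ) where
  carrier := {g | ∀ v : Fin 3 → ℤ, q ((g : Matrix (Fin 3) (Fin 3) ℤ) *ᵥ v) = q v}
  one_mem' := by
    intro v
    simp
  mul_mem' := by
    intro g h hg hh v
    have h1 := hg ((h : Matrix (Fin 3) (Fin 3) ℤ) *ᵥ v)
    rw [Matrix.mulVec_mulVec] at h1
    rw [Units.val_mul, h1, hh v]
  inv_mem' := by
    intro g hg v
    have h1 := hg (((g⁻¹ : GL (Fin 3) ℤ) : Matrix (Fin 3) (Fin 3) ℤ) *ᵥ v)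
    rw [Matrix.mulVec_mulVec, ← Units.val_mul, mul_inv_cancel, Units.val_one,
      Matrix.one_mulVec] at h1
    exact h1.symm

/-- The group `Aut⁺(q)` of automorphs of `q` of determinant `1`. -/
def AutPlus (q : QuadraticForm ℤ (Fin 3 → ℤ)) : Subgroup (GL (Fin 3) ℤ) :=
  Aut q ⊓ (Matrix.GeneralLinearGroup.det : GL (Fin 3) ℤ →* ℤˣ).ker

theorem mem_AutPlus (q : QuadraticForm ℤ (Fin 3 → ℤ)) (g : GL (Fin 3) ℤ) :
    g ∈ AutPlus q ↔
      (∀ v : Fin 3 → ℤ, q ((g : Matrix (Fin 3) (Fin 3) ℤ) *ᵥ v) = q v) ∧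
        (g : Matrix (Fin 3) (Fin 3) ℤ).det = 1 := by
  rw [AutPlus, Subgroup.mem_inf, MonoidHom.mem_ker, Units.ext_iff]
  rfl

/-- The conditions for the form
`a x² + b y² + c z² + 2 r y z + 2 s x z + 2 t x y` to be Eisenstein reduced. -/
structure IsEisensteinReduced (a b c r s t : ℤ) : Prop where
  sign : (0 < r ∧ 0 < s ∧ 0 < t) ∨ (r ≤ 0 ∧ s ≤ 0 ∧ t ≤ 0)
  a_le_b : a ≤ b
  b_le_c : b ≤ c
  eps_nonneg : 0 ≤ a + b + 2 * r + 2 * s + 2 * t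
  two_s_le : |2 * s| ≤ a
  two_t_le : |2 * t| ≤ a
  two_r_le : |2 * r| ≤ b
  of_a_eq_b : a = b → |r| ≤ |s|
  of_b_eq_c : b = c → |s| ≤ |t|
  of_eps_eq_zero : a + b + 2 * r + 2 * s + 2 * t = 0 → a + 2 * s + t ≤ 0
  of_a_eq_neg_two_t : a = -2 * t → s = 0
  of_a_eq_neg_two_s : a = -2 * s → t = 0
  of_b_eq_neg_two_r : b = -2 * r → t = 0
  of_a_eq_two_t : a = 2 * t → s ≤ 2 * r
  of_a_eq_two_s : a = 2 * s → t ≤ 2 * r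
  of_b_eq_two_r : b = 2 * r → t ≤ 2 * s

end TernaryForm

/-!
A definite form has finitely many automorphs, so by Cauchy's theorem `3 ∣ u` yields an automorph
`g` of determinant `1` and order `3`. The form is then found from `g` by using how small the
entries of `g` must be, and the group of each form found is computed by enumeration.

The bounds on entries come from the fact that `a`, `b`, `c` are the successive minima of a reduced
form `q`: `q v ≥ c` if `v` has a nonzero third coordinate, and similarly for the others
(`IsEisensteinReduced.c_le`, `IsEisensteinReduced.b_le`). For non-positive `r`, `s`, `t` this is
read off from Selling's formula, which writes `q` as a nonnegative combination of the squares of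
the coordinates and of their differences; the case of positive `r`, `s`, `t` follows by passing to
absolute values of the coordinates (`IsEisensteinReduced.exists_isObtuse`). The same formula shows
that `q` is superadditive when a nonnegative vector is cut off at height `1`, so that a coordinate
of absolute value `2` or more forces twice the minimum (`IsEisensteinReduced.abs_third_le` and its
companions). Hence the entries of an automorph that are not above the diagonal lie in `{-1, 0, 1}`,
and so do those above it between columns of equal value.

If `a < b < c`, then `g` preserves the flag of short vectors and is unipotent, which contradicts
its order. If `a < b = c`, it fixes `e₁` and acts with order `3` on the quotient; if `a = b < c`,
it acts with order `3` on the plane of `e₁` and `e₂`, which is therefore hexagonal; if `a = b = c`,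
its columns are minimal vectors. In each case finitely many matrices remain, each of them imposes
linear equations on the coefficients, and `IsEisensteinReduced.eq_of_isOrderThree` lists the
reduced forms that satisfy them, in five families.

Each family consists of combinations of two fixed forms, one of which is shown to be preserved by
all automorphs (for instance because a short vector is preserved up to sign). The automorphs are
then those of a fixed integral form, possibly with a condition on some entries. Their entries lie
in `{-1, 0, 1}`, and they can be counted (the lemmas `natCard_fcc` to `natCard_rhombohedral`).
-/

namespace TernaryForm

/-! ### Automorphs as triples of columns -/

/-- The symmetric bilinear form with Gram matrix `!![a, t, s; t, b, r; s, r, c]`, on triples of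
integers. -/
def bil (a b c r s t : ℤ) (u v : ℤ × ℤ × ℤ) : ℤ :=
  a * u.1 * v.1 + b * u.2.1 * v.2.1 + c * u.2.2 * v.2.2
    + r * (u.2.1 * v.2.2 + u.2.2 * v.2.1) + s * (u.1 * v.2.2 + u.2.2 * v.1)
    + t * (u.1 * v.2.1 + u.2.1 * v.1)

/-- The determinant of the matrix with columns `u`, `v`, `w`. -/
def detCols (u v w : ℤ × ℤ × ℤ) : ℤ :=
  u.1 * (v.2.1 * w.2.2 - v.2.2 * w.2.1) - v.1 * (u.2.1 * w.2.2 - u.2.2 * w.2.1)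
    + w.1 * (u.2.1 * v.2.2 - u.2.2 * v.2.1)

/-- The matrix with columns `p.1`, `p.2.1`, `p.2.2` has determinant `1` and preserves the form:
its columns have the same Gram matrix as the standard basis. Triples are used instead of
matrices so that membership in concrete finite sets of them is cheap to decide. -/
def IsAut (a b c r s t : ℤ) (p : (ℤ × ℤ × ℤ) × (ℤ × ℤ × ℤ) × (ℤ × ℤ × ℤ)) : Prop :=
  bil a b c r s t p.1 p.1 = a ∧ bil a b c r s t p.2.1 p.2.1 = b ∧
    bil a b c r s t p.2.2 p.2.2 = c ∧ bil a b c r s t p.2.1 p.2.2 = r ∧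
    bil a b c r s t p.1 p.2.2 = s ∧ bil a b c r s t p.1 p.2.1 = t ∧
    detCols p.1 p.2.1 p.2.2 = 1

instance (a b c r s t : ℤ) : DecidablePred (IsAut a b c r s t) := fun p => by
  unfold IsAut; infer_instance

/-- The matrix with columns `p.1`, `p.2.1`, `p.2.2`. -/
def ofCols (p : (ℤ × ℤ × ℤ) × (ℤ × ℤ × ℤ) × (ℤ × ℤ × ℤ)) : Matrix (Fin 3) (Fin 3) ℤ :=
  !![p.1.1, p.2.1.1, p.2.2.1; p.1.2.1, p.2.1.2.1, p.2.2.2.1; p.1.2.2, p.2.1.2.2, p.2.2.2.2]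

/-- The columns of a matrix, as triples. -/
def cols (M : Matrix (Fin 3) (Fin 3) ℤ) : (ℤ × ℤ × ℤ) × (ℤ × ℤ × ℤ) × (ℤ × ℤ × ℤ) :=
  ((M 0 0, M 1 0, M 2 0), (M 0 1, M 1 1, M 2 1), (M 0 2, M 1 2, M 2 2))

theorem ofCols_cols (M : Matrix (Fin 3) (Fin 3) ℤ) : ofCols (cols M) = M := by
  ext i j
  fin_cases i <;> fin_cases j <;> rfl

theorem isAut_cols_iff (a b c r s t : ℤ) (M : Matrix (Fin 3) (Fin 3) ℤ) :
    IsAut a b c r s t (cols M) ↔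
      (∀ v, form a b c r s t (M *ᵥ v) = form a b c r s t v) ∧ M.det = 1 := by
  have hdet : detCols (cols M).1 (cols M).2.1 (cols M).2.2 = M.det := by
    simp only [detCols, cols, Matrix.det_fin_three]
    ring
  unfold IsAut
  rw [hdet]
  constructor
  · rintro ⟨h1, h2, h3, h4, h5, h6, h7⟩
    refine ⟨fun v => ?_, h7⟩
    simp only [bil, cols] at h1 h2 h3 h4 h5 h6
    simp only [form_apply, Matrix.mulVec, dotProduct, Fin.sum_univ_three]
    linear_combination v 0 ^ 2 * h1 + v 1 ^ 2 * h2 + v 2 ^ 2 * h3 + 2 * v 1 * v 2 * h4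
      + 2 * v 0 * v 2 * h5 + 2 * v 0 * v 1 * h6
  · rintro ⟨h, h7⟩
    have e1 := h ![1, 0, 0]
    have e2 := h ![0, 1, 0]
    have e3 := h ![0, 0, 1]
    have e4 := h ![0, 1, 1]
    have e5 := h ![1, 0, 1]
    have e6 := h ![1, 1, 0]
    simp [form_apply, Matrix.mulVec, dotProduct, Fin.sum_univ_three] at e1 e2 e3 e4 e5 e6
    refine ⟨?_, ?_, ?_, ?_, ?_, ?_, h7⟩ <;> simp only [bil, cols] <;> linarith

theorem mem_autPlus_iff (a b c r s t : ℤ) (g : GL (Fin 3) ℤ) :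
    g ∈ AutPlus (form a b c r s t) ↔
      IsAut a b c r s t (cols (g : Matrix (Fin 3) (Fin 3) ℤ)) := by
  rw [mem_AutPlus, isAut_cols_iff]

/-- Automorphs of determinant `1` correspond to triples of columns. -/
noncomputable def autPlusEquiv (a b c r s t : ℤ) :
    AutPlus (form a b c r s t) ≃ {p // IsAut a b c r s t p} :=
  Equiv.ofBijective
    (fun g => ⟨cols (g : GL (Fin 3) ℤ), (mem_autPlus_iff a b c r s t g).1 g.2⟩) (by
    constructor
    · intro g h hgh
      have h1 := congrArg ofCols (Subtype.ext_iff.1 hgh)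
      simp only [ofCols_cols] at h1
      exact Subtype.ext (Units.ext h1)
    · rintro ⟨p, hp⟩
      have hu : IsUnit (ofCols p) := by
        have h := ((isAut_cols_iff a b c r s t (ofCols p)).1 hp).2
        rw [Matrix.isUnit_iff_isUnit_det, h]
        exact isUnit_one
      obtain ⟨g, hg⟩ := hu
      exact ⟨⟨g, (mem_autPlus_iff a b c r s t g).2 (by rw [hg]; exact hp)⟩,
        Subtype.ext (by simp only [hg]; rfl)⟩)

/-- The vectors with all coordinates in `{-1, 0, 1}`. -/
def box : Finset (ℤ × ℤ × ℤ) := {-1, 0, 1} ×ˢ {-1, 0, 1} ×ˢ {-1, 0, 1}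

theorem mem_box {v : ℤ × ℤ × ℤ} :
    v ∈ box ↔ (-1 ≤ v.1 ∧ v.1 ≤ 1) ∧ (-1 ≤ v.2.1 ∧ v.2.1 ≤ 1) ∧ -1 ≤ v.2.2 ∧ v.2.2 ≤ 1 := by
  simp only [box, Finset.mem_product, Finset.mem_insert, Finset.mem_singleton]
  omega

/-- The automorphs of determinant `1`, as triples of columns, with all entries in `{-1, 0, 1}`. -/
def boxAuts (a b c r s t : ℤ) : Finset ((ℤ × ℤ × ℤ) × (ℤ × ℤ × ℤ) × (ℤ × ℤ × ℤ)) :=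
  ((box.filter fun v => bil a b c r s t v v = a) ×ˢ
    (box.filter fun v => bil a b c r s t v v = b) ×ˢ
    (box.filter fun v => bil a b c r s t v v = c)).filter (IsAut a b c r s t)

theorem mem_boxAuts {a b c r s t : ℤ} {p : (ℤ × ℤ × ℤ) × (ℤ × ℤ × ℤ) × (ℤ × ℤ × ℤ)} :
    p ∈ boxAuts a b c r s t ↔
      (p.1 ∈ box ∧ p.2.1 ∈ box ∧ p.2.2 ∈ box) ∧ IsAut a b c r s t p := by
  simp only [boxAuts, Finset.mem_filter, Finset.mem_product, IsAut]
  tauto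

theorem natCard_autPlus {a b c r s t : ℤ}
    (S : Finset ((ℤ × ℤ × ℤ) × (ℤ × ℤ × ℤ) × (ℤ × ℤ × ℤ)))
    (h : ∀ p, IsAut a b c r s t p ↔ p ∈ S) :
    Nat.card (AutPlus (form a b c r s t)) = S.card := by
  rw [Nat.card_congr (autPlusEquiv a b c r s t), Nat.card_congr (Equiv.subtypeEquivRight h),
    Nat.card_eq_fintype_card, Fintype.card_coe]

/-! ### Successive minima of reduced forms -/

/-- The vectors `e₁, e₂, e₃, -(e₁ + e₂ + e₃)` make pairwise non-acute angles, and `a`, `b`, `c` are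
the successive minima of the form on `{0, 1}³`. This is the part of Eisenstein reduction with
non-positive `r`, `s`, `t` that consists of weak inequalities. -/
structure IsObtuse (a b c r s t : ℤ) : Prop where
  a_pos : 0 < a
  a_le_b : a ≤ b
  b_le_c : b ≤ c
  r_nonpos : r ≤ 0
  s_nonpos : s ≤ 0
  t_nonpos : t ≤ 0
  eps_nonneg : 0 ≤ a + b + 2 * r + 2 * s + 2 * t
  two_s : 0 ≤ a + 2 * s
  two_t : 0 ≤ a + 2 * t
  two_r : 0 ≤ b + 2 * r

/-- Selling's formula. The coefficients on the right are nonnegative for an obtuse form. -/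
theorem bil_eq_selling (a b c r s t : ℤ) (u v : ℤ × ℤ × ℤ) :
    bil a b c r s t u v =
      (a + s + t) * (u.1 * v.1) + (b + r + t) * (u.2.1 * v.2.1) + (c + r + s) * (u.2.2 * v.2.2)
        + -t * ((u.1 - u.2.1) * (v.1 - v.2.1)) + -s * ((u.1 - u.2.2) * (v.1 - v.2.2))
        + -r * ((u.2.1 - u.2.2) * (v.2.1 - v.2.2)) := by
  unfold bil
  ring

theorem le_mul_mul_self_of_ne_zero {p w : ℤ} (hp : 0 ≤ p) (hw : w ≠ 0) : p ≤ p * (w * w) :=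
  le_mul_of_one_le_right hp (mul_self_pos.2 hw)

variable {a b c r s t : ℤ}

namespace IsObtuse

theorem c_le (h : IsObtuse a b c r s t) {v : ℤ × ℤ × ℤ} (hz : v.2.2 ≠ 0) :
    c ≤ bil a b c r s t v v := by
  obtain ⟨ha, hab, hbc, hr, hs, ht, he, h1, h2, h3⟩ := h
  obtain ⟨x, y, z⟩ := v
  replace hz : z ≠ 0 := hz
  have gen0 : ∀ {p : ℤ} (w : ℤ), 0 ≤ p → 0 ≤ p * (w * w) :=
    fun w hp => mul_nonneg hp (mul_self_nonneg w)
  have p1 : 0 ≤ a + s + t := by linarith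
  have p2 : 0 ≤ b + r + t := by linarith
  have p3 : 0 ≤ c + r + s := by linarith
  have pt : 0 ≤ -t := by linarith
  have ps : 0 ≤ -s := by linarith
  have pr : 0 ≤ -r := by linarith
  rw [bil_eq_selling]
  dsimp only
  have q3 := le_mul_mul_self_of_ne_zero p3 hz
  have t1 := gen0 x p1
  have t2 := gen0 y p2
  have t4 := gen0 (x - y) pt
  have t5 := gen0 (x - z) ps
  have t6 := gen0 (y - z) pr
  -- The terms that vanish, according to which of `x`, `y` equal `z`, are made up for by others.
  rcases eq_or_ne x z with hxz | hxz <;> rcases eq_or_ne y z with hyz | hyz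
  · have q1 := le_mul_mul_self_of_ne_zero p1 (hxz ▸ hz : x ≠ 0)
    have q2 := le_mul_mul_self_of_ne_zero p2 (hyz ▸ hz : y ≠ 0)
    linarith
  · have q1 := le_mul_mul_self_of_ne_zero p1 (hxz ▸ hz : x ≠ 0)
    have q4 := le_mul_mul_self_of_ne_zero pt (sub_ne_zero.2 (hxz ▸ hyz.symm : x ≠ y))
    have q6 := le_mul_mul_self_of_ne_zero pr (sub_ne_zero.2 hyz)
    linarith
  · have q2 := le_mul_mul_self_of_ne_zero p2 (hyz ▸ hz : y ≠ 0)
    have q4 := le_mul_mul_self_of_ne_zero pt (sub_ne_zero.2 (hyz ▸ hxz : x ≠ y))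
    have q5 := le_mul_mul_self_of_ne_zero ps (sub_ne_zero.2 hxz)
    linarith
  · have q5 := le_mul_mul_self_of_ne_zero ps (sub_ne_zero.2 hxz)
    have q6 := le_mul_mul_self_of_ne_zero pr (sub_ne_zero.2 hyz)
    linarith

theorem b_le (h : IsObtuse a b c r s t) {v : ℤ × ℤ × ℤ} (hy : v.2.1 ≠ 0) :
    b ≤ bil a b c r s t v v := by
  by_cases hz : v.2.2 = 0
  · obtain ⟨ha, hab, hbc, hr, hs, ht, he, h1, h2, h3⟩ := h
    obtain ⟨x, y, z⟩ := v
    dsimp only at hy hz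
    subst hz
    have e : bil a b c r s t (x, y, 0) (x, y, 0) =
        (a + t) * (x * x) + (b + t) * (y * y) + -t * ((x - y) * (x - y)) := by
      unfold bil
      ring
    rw [e]
    have q2 := le_mul_mul_self_of_ne_zero (by linarith : 0 ≤ b + t) hy
    rcases eq_or_ne x y with hxy | hxy
    · have q1 := le_mul_mul_self_of_ne_zero (by linarith : 0 ≤ a + t) (hxy ▸ hy : x ≠ 0)
      have t4 := mul_nonneg (by linarith : 0 ≤ -t) (mul_self_nonneg (x - y))
      linarith
    · have q4 := le_mul_mul_self_of_ne_zero (by linarith : 0 ≤ -t) (sub_ne_zero.2 hxy)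
      have t1 := mul_nonneg (by linarith : 0 ≤ a + t) (mul_self_nonneg x)
      linarith
  · exact h.b_le_c.trans (h.c_le hz)

theorem a_le (h : IsObtuse a b c r s t) {v : ℤ × ℤ × ℤ} (hx : v.1 ≠ 0) :
    a ≤ bil a b c r s t v v := by
  by_cases hz : v.2.2 = 0
  · by_cases hy : v.2.1 = 0
    · have := le_mul_mul_self_of_ne_zero h.a_pos.le hx
      simp only [bil, hy, hz]
      linarith
    · exact h.a_le_b.trans (h.b_le hy)
  · exact h.a_le_b.trans (h.b_le_c.trans (h.c_le hz))

/-- Cutting a nonnegative vector off at height `1` leaves two vectors that are similarly ordered,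
so that by Selling's formula their product is nonnegative. -/
theorem bil_cut_le (h : IsObtuse a b c r s t) {x y z : ℤ} (hx : 0 ≤ x) (hy : 0 ≤ y) (hz : 0 ≤ z) :
    bil a b c r s t (min x 1, min y 1, min z 1) (min x 1, min y 1, min z 1) +
      bil a b c r s t (x - min x 1, y - min y 1, z - min z 1)
        (x - min x 1, y - min y 1, z - min z 1) ≤ bil a b c r s t (x, y, z) (x, y, z) := by
  have key : 0 ≤ bil a b c r s t (min x 1, min y 1, min z 1)
      (x - min x 1, y - min y 1, z - min z 1) := by
    obtain ⟨ha, hab, hbc, hr, hs, ht, he, h1, h2, h3⟩ := h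
    have hpos : ∀ {w : ℤ}, 0 ≤ w → 0 ≤ min w 1 * (w - min w 1) := fun hw =>
      mul_nonneg (by omega) (by omega)
    have hmono : ∀ w w' : ℤ, 0 ≤ (min w 1 - min w' 1) * ((w - min w 1) - (w' - min w' 1)) := by
      intro w w'
      rcases le_total w w' with hw | hw
      · exact mul_nonneg_of_nonpos_of_nonpos (by omega) (by omega)
      · exact mul_nonneg (by omega) (by omega)
    rw [bil_eq_selling]
    have p1 := mul_nonneg (by linarith : 0 ≤ a + s + t) (hpos hx)
    have p2 := mul_nonneg (by linarith : 0 ≤ b + r + t) (hpos hy)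
    have p3 := mul_nonneg (by linarith : 0 ≤ c + r + s) (hpos hz)
    have p4 := mul_nonneg (by linarith : 0 ≤ -t) (hmono x y)
    have p5 := mul_nonneg (by linarith : 0 ≤ -s) (hmono x z)
    have p6 := mul_nonneg (by linarith : 0 ≤ -r) (hmono y z)
    linarith
  have e : bil a b c r s t (x, y, z) (x, y, z) =
      bil a b c r s t (min x 1, min y 1, min z 1) (min x 1, min y 1, min z 1) +
      bil a b c r s t (x - min x 1, y - min y 1, z - min z 1)
        (x - min x 1, y - min y 1, z - min z 1) +
      2 * bil a b c r s t (min x 1, min y 1, min z 1)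
        (x - min x 1, y - min y 1, z - min z 1) := by
    unfold bil
    ring
  linarith

end IsObtuse

/-- With absolute values, at most two of the three mixed terms are negative unless the form is
obtuse already, and dropping the positive ones leaves an obtuse form. -/
theorem IsEisensteinReduced.exists_isObtuse (h : IsEisensteinReduced a b c r s t) (ha : 0 < a)
    (x y z : ℤ) : ∃ r' s' t', IsObtuse a b c r' s' t' ∧
      bil a b c r' s' t' (|x|, |y|, |z|) (|x|, |y|, |z|) ≤ bil a b c r s t (x, y, z) (x, y, z) := by
  obtain ⟨hsign, hab, hbc, he, hs, ht, hr, -⟩ := h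
  rw [abs_le] at hs ht hr
  -- It is enough that each mixed term can only decrease.
  have red : ∀ r' s' t', IsObtuse a b c r' s' t' → r' * |y * z| ≤ r * (y * z) →
      s' * |x * z| ≤ s * (x * z) → t' * |x * y| ≤ t * (x * y) →
      ∃ r' s' t', IsObtuse a b c r' s' t' ∧ bil a b c r' s' t' (|x|, |y|, |z|) (|x|, |y|, |z|)
        ≤ bil a b c r s t (x, y, z) (x, y, z) := by
    intro r' s' t' ho h1 h2 h3
    refine ⟨r', s', t', ho, ?_⟩
    rw [abs_mul] at h1 h2 h3
    unfold bil
    linarith [congrArg (a * ·) (abs_mul_abs_self x), congrArg (b * ·) (abs_mul_abs_self y),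
      congrArg (c * ·) (abs_mul_abs_self z)]
  have neg : ∀ k w : ℤ, 0 ≤ k → -k * |w| ≤ k * w := fun k w hk => by
    have := mul_le_mul_of_nonneg_left (neg_abs_le w) hk
    linarith
  have pos : ∀ k w : ℤ, 0 ≤ k → 0 ≤ w → 0 * |w| ≤ k * w := fun k w hk hw => by
    have := mul_nonneg hk hw
    linarith
  have nonpos : ∀ k w : ℤ, k ≤ 0 → k * |w| ≤ k * w := fun k w hk =>
    mul_le_mul_of_nonpos_left (le_abs_self w) hk
  rcases hsign with ⟨hr0, hs0, ht0⟩ | ⟨hr0, hs0, ht0⟩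
  · rcases le_total 0 (y * z) with hw | hw
    · exact red 0 (-s) (-t) (by constructor <;> linarith) (pos _ _ hr0.le hw) (neg _ _ hs0.le)
        (neg _ _ ht0.le)
    · rcases le_total 0 (x * z) with hw' | hw'
      · exact red (-r) 0 (-t) (by constructor <;> linarith) (neg _ _ hr0.le) (pos _ _ hs0.le hw')
          (neg _ _ ht0.le)
      · rcases le_total 0 (x * y) with hw'' | hw''
        · exact red (-r) (-s) 0 (by constructor <;> linarith) (neg _ _ hr0.le) (neg _ _ hs0.le)
            (pos _ _ ht0.le hw'')
        · -- The product of the three mixed monomials is a square, hence one of them vanishes.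
          have hz : y * z = 0 ∨ x * z = 0 := by
            by_contra! hne
            have h1 := mul_pos_of_neg_of_neg (lt_of_le_of_ne hw hne.1) (lt_of_le_of_ne hw' hne.2)
            have h2 := mul_nonneg h1.le (neg_nonneg.2 hw'')
            have hxy : x * y = 0 := by nlinarith [sq_nonneg (x * y * z), mul_pos h1 h1]
            rcases mul_eq_zero.1 hxy with rfl | rfl <;> simp at h1
          rcases hz with hz | hz
          · exact red 0 (-s) (-t) (by constructor <;> linarith) (pos _ _ hr0.le hz.ge)
              (neg _ _ hs0.le) (neg _ _ ht0.le)
          · exact red (-r) 0 (-t) (by constructor <;> linarith) (neg _ _ hr0.le)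
              (pos _ _ hs0.le hz.ge) (neg _ _ ht0.le)
  · exact red r s t (by constructor <;> linarith) (nonpos _ _ hr0) (nonpos _ _ hs0)
      (nonpos _ _ ht0)

namespace IsEisensteinReduced

theorem c_le (h : IsEisensteinReduced a b c r s t) (ha : 0 < a) {v : ℤ × ℤ × ℤ}
    (hz : v.2.2 ≠ 0) : c ≤ bil a b c r s t v v := by
  obtain ⟨r', s', t', ho, hle⟩ := h.exists_isObtuse ha v.1 v.2.1 v.2.2
  exact (ho.c_le (abs_ne_zero.2 hz)).trans hle

theorem b_le (h : IsEisensteinReduced a b c r s t) (ha : 0 < a) {v : ℤ × ℤ × ℤ}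
    (hy : v.2.1 ≠ 0) : b ≤ bil a b c r s t v v := by
  obtain ⟨r', s', t', ho, hle⟩ := h.exists_isObtuse ha v.1 v.2.1 v.2.2
  exact (ho.b_le (abs_ne_zero.2 hy)).trans hle

theorem abs_third_le (h : IsEisensteinReduced a b c r s t) (ha : 0 < a) {v : ℤ × ℤ × ℤ}
    (hv : bil a b c r s t v v < 2 * c) : |v.2.2| ≤ 1 := by
  by_contra! hz
  obtain ⟨r', s', t', ho, hle⟩ := h.exists_isObtuse ha v.1 v.2.1 v.2.2
  have h1 := ho.bil_cut_le (abs_nonneg v.1) (abs_nonneg v.2.1) (abs_nonneg v.2.2)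
  have h2 := ho.c_le (v := (min |v.1| 1, min |v.2.1| 1, min |v.2.2| 1)) (by dsimp only; omega)
  have h3 := ho.c_le (v := (|v.1| - min |v.1| 1, |v.2.1| - min |v.2.1| 1,
    |v.2.2| - min |v.2.2| 1)) (by dsimp only; omega)
  linarith

theorem abs_second_le (h : IsEisensteinReduced a b c r s t) (ha : 0 < a) {v : ℤ × ℤ × ℤ}
    (hv : bil a b c r s t v v < 2 * b) : |v.2.1| ≤ 1 := by
  by_contra! hy
  obtain ⟨r', s', t', ho, hle⟩ := h.exists_isObtuse ha v.1 v.2.1 v.2.2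
  have h1 := ho.bil_cut_le (abs_nonneg v.1) (abs_nonneg v.2.1) (abs_nonneg v.2.2)
  have h2 := ho.b_le (v := (min |v.1| 1, min |v.2.1| 1, min |v.2.2| 1)) (by dsimp only; omega)
  have h3 := ho.b_le (v := (|v.1| - min |v.1| 1, |v.2.1| - min |v.2.1| 1,
    |v.2.2| - min |v.2.2| 1)) (by dsimp only; omega)
  linarith

theorem abs_first_le (h : IsEisensteinReduced a b c r s t) (ha : 0 < a) {v : ℤ × ℤ × ℤ}
    (hv : bil a b c r s t v v < 2 * a) : |v.1| ≤ 1 := by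
  by_contra! hx
  obtain ⟨r', s', t', ho, hle⟩ := h.exists_isObtuse ha v.1 v.2.1 v.2.2
  have h1 := ho.bil_cut_le (abs_nonneg v.1) (abs_nonneg v.2.1) (abs_nonneg v.2.2)
  have h2 := ho.a_le (v := (min |v.1| 1, min |v.2.1| 1, min |v.2.2| 1)) (by dsimp only; omega)
  have h3 := ho.a_le (v := (|v.1| - min |v.1| 1, |v.2.1| - min |v.2.1| 1,
    |v.2.2| - min |v.2.2| 1)) (by dsimp only; omega)
  linarith

end IsEisensteinReduced

/-! ### Existence of an automorph of order three -/

/-- The matrix with columns `p.1`, `p.2.1`, `p.2.2` applied to a vector. -/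
def app (p : (ℤ × ℤ × ℤ) × (ℤ × ℤ × ℤ) × (ℤ × ℤ × ℤ)) (v : ℤ × ℤ × ℤ) : ℤ × ℤ × ℤ :=
  (p.1.1 * v.1 + p.2.1.1 * v.2.1 + p.2.2.1 * v.2.2,
    p.1.2.1 * v.1 + p.2.1.2.1 * v.2.1 + p.2.2.2.1 * v.2.2,
    p.1.2.2 * v.1 + p.2.1.2.2 * v.2.1 + p.2.2.2.2 * v.2.2)

/-- The matrix with columns `p.1`, `p.2.1`, `p.2.2` has order `3`. -/
def IsOrderThree (p : (ℤ × ℤ × ℤ) × (ℤ × ℤ × ℤ) × (ℤ × ℤ × ℤ)) : Prop :=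
  p ≠ ((1, 0, 0), (0, 1, 0), (0, 0, 1)) ∧ app p (app p p.1) = (1, 0, 0) ∧
    app p (app p p.2.1) = (0, 1, 0) ∧ app p (app p p.2.2) = (0, 0, 1)

instance : DecidablePred IsOrderThree := fun p => by
  unfold IsOrderThree; infer_instance

theorem isOrderThree_cols {g : GL (Fin 3) ℤ} (hg : orderOf g = 3) :
    IsOrderThree (cols (g : Matrix (Fin 3) (Fin 3) ℤ)) := by
  have h3 : (g : Matrix (Fin 3) (Fin 3) ℤ) * (g * g) = 1 := by
    have h := pow_orderOf_eq_one g
    rw [hg, pow_three] at h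
    exact congrArg Units.val h
  refine ⟨fun h => ?_, ?_⟩
  · have h1 : g = 1 := by
      apply Units.ext
      rw [← ofCols_cols (g : Matrix (Fin 3) (Fin 3) ℤ), h]
      ext i j
      fin_cases i <;> fin_cases j <;> rfl
    rw [h1, orderOf_one] at hg
    omega
  · have e : ∀ i j, ((g : Matrix (Fin 3) (Fin 3) ℤ) * (g * g)) i j = (1 : Matrix _ _ ℤ) i j :=
      fun i j => by rw [h3]
    simp only [Matrix.mul_apply, Fin.sum_univ_three] at e
    simp only [app, cols, Prod.mk.injEq]
    exact ⟨⟨e 0 0, e 1 0, e 2 0⟩, ⟨e 0 1, e 1 1, e 2 1⟩, e 0 2, e 1 2, e 2 2⟩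

/-- A bound for the last coordinate of a vector of given value, by completing squares twice. -/
theorem sq_le_minor_mul (ha : 0 < a) (hm : 0 < a * b - t ^ 2)
    (hdet : 0 < a * b * c + 2 * r * s * t - a * r ^ 2 - b * s ^ 2 - c * t ^ 2) (x y z : ℤ) :
    z ^ 2 ≤ (a * b - t ^ 2) * bil a b c r s t (x, y, z) (x, y, z) := by
  set d := a * b * c + 2 * r * s * t - a * r ^ 2 - b * s ^ 2 - c * t ^ 2 with hd
  have key : a * ((a * b - t ^ 2) * bil a b c r s t (x, y, z) (x, y, z)) =
      (a * b - t ^ 2) * (a * x + t * y + s * z) ^ 2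
        + ((a * b - t ^ 2) * y + (a * r - s * t) * z) ^ 2 + a * d * z ^ 2 := by
    rw [hd]
    unfold bil
    ring
  have h1 : a * z ^ 2 ≤ a * d * z ^ 2 := by
    nlinarith [mul_nonneg ha.le (sq_nonneg z)]
  have h2 := mul_nonneg hm.le (sq_nonneg (a * x + t * y + s * z))
  have h3 := sq_nonneg ((a * b - t ^ 2) * y + (a * r - s * t) * z)
  exact le_of_mul_le_mul_left (by linarith) ha

theorem form_eq_bil (x y z : ℤ) :
    form a b c r s t ![x, y, z] = bil a b c r s t (x, y, z) (x, y, z) := by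
  simp only [form_apply, bil, Matrix.cons_val_zero, Matrix.cons_val_one, Matrix.cons_val]
  ring

theorem a_pos_of_posDef (hpos : (form a b c r s t).PosDef) : 0 < a := by
  have h := hpos ![1, 0, 0] (by simp)
  rw [form_eq_bil] at h
  simpa [bil] using h

/-- Each column has a prescribed value, and a definite form takes it finitely often. -/
theorem finite_isAut (hpos : (form a b c r s t).PosDef) (h : IsEisensteinReduced a b c r s t) :
    Finite {p // IsAut a b c r s t p} := by
  have ha := a_pos_of_posDef hpos
  obtain ⟨-, hab, hbc, -, hs, ht, hr, -⟩ := h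
  rw [abs_le] at hs ht hr
  have m3 : 0 < a * b - t ^ 2 := by nlinarith
  have m2 : 0 < a * c - s ^ 2 := by nlinarith
  have m1 : 0 < b * c - r ^ 2 := by nlinarith
  have hdet : 0 < a * b * c + 2 * r * s * t - a * r ^ 2 - b * s ^ 2 - c * t ^ 2 := by
    -- Evaluate the form at the third column of the adjugate matrix.
    have hv := hpos ![t * r - s * b, t * s - a * r, a * b - t ^ 2]
      (fun h => m3.ne' (by simpa using congrFun h 2))
    rw [form_eq_bil] at hv
    refine pos_of_mul_pos_right (a := a * b - t ^ 2) (lt_of_lt_of_eq hv ?_) m3.le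
    unfold bil
    ring
  have bound : ∀ {x z K : ℤ}, z ^ 2 ≤ K → z ∈ Finset.Icc (-K) K := fun {x z K} hz => by
    rw [Finset.mem_Icc]
    constructor <;> nlinarith [Int.le_self_sq z, Int.le_self_sq (-z)]
  have fin : ∀ n : ℤ, {v : ℤ × ℤ × ℤ | bil a b c r s t v v = n}.Finite := by
    intro n
    refine (Finset.finite_toSet (Finset.Icc (-((b * c - r ^ 2) * n)) ((b * c - r ^ 2) * n) ×ˢ
      Finset.Icc (-((a * c - s ^ 2) * n)) ((a * c - s ^ 2) * n) ×ˢ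
      Finset.Icc (-((a * b - t ^ 2) * n)) ((a * b - t ^ 2) * n))).subset ?_
    rintro ⟨x, y, z⟩ hv
    have hv' : bil a b c r s t (x, y, z) (x, y, z) = n := hv
    have h3 := sq_le_minor_mul ha m3 hdet x y z
    have h2 := sq_le_minor_mul (a := a) (b := c) (c := b) (r := r) (s := t) (t := s) ha m2
      (by linarith) x z y
    have h1 := sq_le_minor_mul (a := b) (b := c) (c := a) (r := s) (s := t) (t := r) (by linarith)
      m1 (by linarith) y z x
    rw [hv'] at h3
    rw [show bil a c b r t s (x, z, y) (x, z, y) = n by rw [← hv']; unfold bil; ring] at h2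
    rw [show bil b c a s t r (y, z, x) (y, z, x) = n by rw [← hv']; unfold bil; ring] at h1
    simp only [Finset.coe_product, Set.mem_prod, Finset.mem_coe]
    exact ⟨bound (x := 0) h1, bound (x := 0) h2, bound (x := 0) h3⟩
  exact Set.Finite.to_subtype (s := {p | IsAut a b c r s t p})
    (((fin a).prod ((fin b).prod (fin c))).subset fun p hp => ⟨hp.1, hp.2.1, hp.2.2.1⟩)

/-- Cauchy's theorem. Finiteness of the group is essential here, since `Nat.card` of an infinite
group is `0`, which `3` divides. -/
theorem exists_isOrderThree (hpos : (form a b c r s t).PosDef)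
    (h : IsEisensteinReduced a b c r s t) (h3 : 3 ∣ Nat.card (AutPlus (form a b c r s t))) :
    ∃ p, IsAut a b c r s t p ∧ IsOrderThree p := by
  have := finite_isAut hpos h
  have : Finite (AutPlus (form a b c r s t)) := Finite.of_equiv _ (autPlusEquiv a b c r s t).symm
  have : Fact (Nat.Prime 3) := ⟨Nat.prime_three⟩
  obtain ⟨g, hg⟩ := exists_prime_orderOf_dvd_card' 3 h3
  exact ⟨_, (mem_autPlus_iff a b c r s t g).1 g.2,
    isOrderThree_cols ((Subgroup.orderOf_coe g).trans hg)⟩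

/-! ### The number of automorphs in each family -/

theorem isAut_mul_iff {k : ℤ} (hk : k ≠ 0) {p : (ℤ × ℤ × ℤ) × (ℤ × ℤ × ℤ) × (ℤ × ℤ × ℤ)} :
    IsAut (k * a) (k * b) (k * c) (k * r) (k * s) (k * t) p ↔ IsAut a b c r s t p := by
  have e : ∀ u v, bil (k * a) (k * b) (k * c) (k * r) (k * s) (k * t) u v
      = k * bil a b c r s t u v := fun u v => by unfold bil; ring
  simp only [IsAut, e, mul_right_inj' hk]

theorem IsEisensteinReduced.mem_box_of_bil_eq (h : IsEisensteinReduced a a a r s t) (ha : 0 < a)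
    {v : ℤ × ℤ × ℤ} (hv : bil a a a r s t v v = a) : v ∈ box := by
  have hlt : bil a a a r s t v v < 2 * a := by linarith
  exact mem_box.2 ⟨abs_le.1 (h.abs_first_le ha hlt), abs_le.1 (h.abs_second_le ha hlt),
    abs_le.1 (h.abs_third_le ha hlt)⟩

theorem IsEisensteinReduced.isAut_iff_mem_boxAuts (h : IsEisensteinReduced a a a r s t)
    (ha : 0 < a) {p : (ℤ × ℤ × ℤ) × (ℤ × ℤ × ℤ) × (ℤ × ℤ × ℤ)} :
    IsAut a a a r s t p ↔ p ∈ boxAuts a a a r s t := by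
  rw [mem_boxAuts]
  have hb := fun v => h.mem_box_of_bil_eq ha (v := v)
  exact ⟨fun hp => ⟨⟨hb _ hp.1, hb _ hp.2.1, hb _ hp.2.2.1⟩, hp⟩, And.right⟩

theorem isEisensteinReduced_fcc : IsEisensteinReduced 2 2 2 1 1 1 := by
  constructor <;> decide

theorem isEisensteinReduced_bcc : IsEisensteinReduced 3 3 3 (-1) (-1) (-1) := by
  constructor <;> decide

theorem isEisensteinReduced_cubic : IsEisensteinReduced 1 1 1 0 0 0 := by
  constructor <;> decide

theorem isEisensteinReduced_hex : IsEisensteinReduced 2 2 2 0 0 (-1) := by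
  constructor <;> decide

/-- The face-centred cubic lattice. -/
theorem natCard_fcc {k : ℤ} (hk : 0 < k) :
    Nat.card (AutPlus (form (k * 2) (k * 2) (k * 2) (k * 1) (k * 1) (k * 1))) = 24 := by
  rw [natCard_autPlus (boxAuts 2 2 2 1 1 1) fun p => (isAut_mul_iff hk.ne').trans
    (isEisensteinReduced_fcc.isAut_iff_mem_boxAuts two_pos)]
  decide +kernel

/-- The body-centred cubic lattice. -/
theorem natCard_bcc {k : ℤ} (hk : 0 < k) :
    Nat.card (AutPlus (form (k * 3) (k * 3) (k * 3) (k * -1) (k * -1) (k * -1))) = 24 := by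
  rw [natCard_autPlus (boxAuts 3 3 3 (-1) (-1) (-1)) fun p => (isAut_mul_iff hk.ne').trans
    (isEisensteinReduced_bcc.isAut_iff_mem_boxAuts three_pos)]
  decide +kernel

/-- The primitive cubic lattice. -/
theorem natCard_cubic {k : ℤ} (hk : 0 < k) :
    Nat.card (AutPlus (form (k * 1) (k * 1) (k * 1) (k * 0) (k * 0) (k * 0))) = 24 := by
  rw [natCard_autPlus (boxAuts 1 1 1 0 0 0) fun p => (isAut_mul_iff hk.ne').trans
    (isEisensteinReduced_cubic.isAut_iff_mem_boxAuts one_pos)]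
  decide +kernel

/-- The plane of `e₁` and `e₂` is preserved when `b < c`, and so is the third coordinate, up to
sign. -/
theorem IsEisensteinReduced.isAut_third (h : IsEisensteinReduced a b c r s t) (ha : 0 < a)
    (hbc : b < c) {p : (ℤ × ℤ × ℤ) × (ℤ × ℤ × ℤ) × (ℤ × ℤ × ℤ)} (hp : IsAut a b c r s t p) :
    p.1.2.2 = 0 ∧ p.2.1.2.2 = 0 ∧ p.2.2.2.2 * p.2.2.2.2 = 1 := by
  have h1 : p.1.2.2 = 0 := by
    by_contra hz
    have h1 := h.c_le ha hz
    have h2 := h.a_le_b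
    rw [hp.1] at h1
    omega
  have h2 : p.2.1.2.2 = 0 := by
    by_contra hz
    have h1 := h.c_le ha hz
    rw [hp.2.1] at h1
    omega
  refine ⟨h1, h2, ?_⟩
  have hd := hp.2.2.2.2.2.2
  simp only [detCols, h1, h2] at hd
  have hu : IsUnit p.2.2.2.2 := IsUnit.of_mul_eq_one
    (p.1.1 * p.2.1.2.1 - p.2.1.1 * p.1.2.1) (by linarith)
  rcases Int.isUnit_iff.1 hu with hz | hz <;> rw [hz] <;> rfl

/-- The vector `e₁` is preserved up to sign when `a < b`. -/
theorem IsEisensteinReduced.isAut_first (h : IsEisensteinReduced a b c r s t) (ha : 0 < a)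
    (hab : a < b) {p : (ℤ × ℤ × ℤ) × (ℤ × ℤ × ℤ) × (ℤ × ℤ × ℤ)} (hp : IsAut a b c r s t p) :
    p.1.2.1 = 0 ∧ p.1.2.2 = 0 ∧ (p.1.1 = 1 ∨ p.1.1 = -1) := by
  have h1 : p.1.2.1 = 0 := by
    by_contra hz
    have h1 := h.b_le ha hz
    rw [hp.1] at h1
    omega
  have h2 : p.1.2.2 = 0 := by
    by_contra hz
    have h1 := h.c_le ha hz
    have h2 := h.b_le_c
    rw [hp.1] at h1
    omega
  refine ⟨h1, h2, ?_⟩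
  have hd := hp.2.2.2.2.2.2
  simp only [detCols, h1, h2] at hd
  exact Int.isUnit_iff.1 (IsUnit.of_mul_eq_one
    (p.2.1.2.1 * p.2.2.2.2 - p.2.1.2.2 * p.2.2.2.1) (by linarith))

/-- The face-centred cubic lattice stretched orthogonally to one of its hexagonal planes: the
automorphs are those of the cubic lattice that preserve the plane. -/
theorem natCard_fcc_stretched {k d : ℤ} (hk : 0 < k) (hd : 0 < d)
    (h : IsEisensteinReduced (k * 2) (k * 2) (k * 2 + d) k k k) :
    Nat.card (AutPlus (form (k * 2) (k * 2) (k * 2 + d) k k k)) = 6 := by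
  rw [natCard_autPlus ((boxAuts 2 2 2 1 1 1).filter fun p => p.1.2.2 = 0 ∧ p.2.1.2.2 = 0 ∧
    p.2.2.2.2 * p.2.2.2.2 = 1)]
  · decide +kernel
  intro p
  rw [Finset.mem_filter, ← isEisensteinReduced_fcc.isAut_iff_mem_boxAuts two_pos,
    ← isAut_mul_iff (a := 2) hk.ne']
  have e : ∀ u v, bil (k * 2) (k * 2) (k * 2 + d) k k k u v =
    bil (k * 2) (k * 2) (k * 2) (k * 1) (k * 1) (k * 1) u v + d * (u.2.2 * v.2.2) :=
      fun u v => by unfold bil; ring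
  have key : (p.1.2.2 = 0 ∧ p.2.1.2.2 = 0 ∧ p.2.2.2.2 * p.2.2.2.2 = 1) →
      (IsAut (k * 2) (k * 2) (k * 2 + d) k k k p ↔
        IsAut (k * 2) (k * 2) (k * 2) (k * 1) (k * 1) (k * 1) p) := by
    rintro ⟨h1, h2, h3⟩
    simp only [IsAut, e, h1, h2, h3, mul_one, mul_zero, zero_mul, add_zero, add_left_inj]
  exact ⟨fun hp => have h3 := h.isAut_third (by omega) (by omega) hp; ⟨(key h3).1 hp, h3⟩,
    fun hp => (key hp.2).2 hp.1⟩

/-- Orthogonal sums of a hexagonal plane lattice and a line. The line may have the same minimum as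
the plane (`d = 0`), but the automorphs of that lattice preserve the decomposition too. -/
theorem natCard_hex_third {k d : ℤ} (hk : 0 < k) (hd : 0 ≤ d)
    (h : IsEisensteinReduced (k * 2) (k * 2) (k * 2 + d) 0 0 (-k)) :
    Nat.card (AutPlus (form (k * 2) (k * 2) (k * 2 + d) 0 0 (-k))) = 12 := by
  rw [natCard_autPlus (boxAuts 2 2 2 0 0 (-1))]
  · decide +kernel
  intro p
  have e : ∀ u v, bil (k * 2) (k * 2) (k * 2 + d) 0 0 (-k) u v =
    bil (k * 2) (k * 2) (k * 2) (k * 0) (k * 0) (k * -1) u v + d * (u.2.2 * v.2.2) :=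
      fun u v => by unfold bil; ring
  have e0 : IsAut (k * 2) (k * 2) (k * 2) (k * 0) (k * 0) (k * -1) p ↔
      p ∈ boxAuts 2 2 2 0 0 (-1) :=
    (isAut_mul_iff hk.ne').trans (isEisensteinReduced_hex.isAut_iff_mem_boxAuts two_pos)
  have h3 : ∀ p ∈ boxAuts 2 2 2 0 0 (-1),
      p.1.2.2 = 0 ∧ p.2.1.2.2 = 0 ∧ p.2.2.2.2 * p.2.2.2.2 = 1 := by decide +kernel
  rw [← e0]
  have key : (p.1.2.2 = 0 ∧ p.2.1.2.2 = 0 ∧ p.2.2.2.2 * p.2.2.2.2 = 1) →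
      (IsAut (k * 2) (k * 2) (k * 2 + d) 0 0 (-k) p ↔
        IsAut (k * 2) (k * 2) (k * 2) (k * 0) (k * 0) (k * -1) p) := by
    rintro ⟨h1, h2, h3⟩
    simp only [IsAut, e, h1, h2, h3, mul_one, mul_zero, mul_neg, zero_mul, add_zero, add_left_inj]
  rcases hd.eq_or_lt with rfl | hd
  · simp only [add_zero, mul_zero, mul_neg, mul_one]
  · exact ⟨fun hp => (key (h.isAut_third (by omega) (by omega) hp)).1 hp,
      fun hp => (key (h3 p (e0.1 hp))).2 hp⟩

/-- Orthogonal sums of a line and a hexagonal plane lattice with a larger minimum. As `e₁` is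
preserved up to sign, only the value on it being nonzero matters, and it may be replaced by `1`
while the plane is rescaled. -/
theorem natCard_hex_first {a k : ℤ} (ha : 0 < a) (hak : a < k * 2)
    (h : IsEisensteinReduced a (k * 2) (k * 2) (-k) 0 0) :
    Nat.card (AutPlus (form a (k * 2) (k * 2) (-k) 0 0)) = 12 := by
  rw [natCard_autPlus (boxAuts 1 2 2 (-1) 0 0)]
  · decide +kernel
  intro p
  have e : ∀ u v, bil a (k * 2) (k * 2) (-k) 0 0 u v =
    k * bil 1 2 2 (-1) 0 0 u v + (a - k) * (u.1 * v.1) :=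
      fun u v => by unfold bil; ring
  have key : (p.1.1 * p.1.1 = 1 ∧ p.2.1.1 = 0 ∧ p.2.2.1 = 0) →
      (IsAut a (k * 2) (k * 2) (-k) 0 0 p ↔ IsAut 1 2 2 (-1) 0 0 p) := by
    rintro ⟨h1, h2, h3⟩
    have hk : k ≠ 0 := by omega
    have e1 : k * bil 1 2 2 (-1) 0 0 p.1 p.1 + (a - k) = a ↔ bil 1 2 2 (-1) 0 0 p.1 p.1 = 1 :=
      ⟨fun h => mul_left_cancel₀ hk (by linarith), fun h => by rw [h]; ring⟩
    have e2 : k * bil 1 2 2 (-1) 0 0 p.2.1 p.2.2 = -k ↔ bil 1 2 2 (-1) 0 0 p.2.1 p.2.2 = -1 :=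
      ⟨fun h => mul_left_cancel₀ hk (by linarith), fun h => by rw [h]; ring⟩
    simp only [IsAut, e, h1, h2, h3, mul_one, mul_zero, add_zero, e1, e2,
      mul_right_inj' hk, mul_eq_zero, hk, false_or]
  have h3 : ∀ p ∈ boxAuts 1 2 2 (-1) 0 0,
      p.1.1 * p.1.1 = 1 ∧ p.2.1.1 = 0 ∧ p.2.2.1 = 0 := by decide +kernel
  refine ⟨fun hp => ?_, fun hp => (key (h3 p hp)).2 (mem_boxAuts.1 hp).2⟩
  obtain ⟨h1, h2, h4⟩ := h.isAut_first ha hak hp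
  have h11 : p.1.1 * p.1.1 = 1 := by rcases h4 with h4 | h4 <;> rw [h4] <;> rfl
  have h5 := hp.2.2.2.2.1
  have h6 := hp.2.2.2.2.2.1
  have hne : a * p.1.1 ≠ 0 := mul_ne_zero ha.ne' (by rintro h0; simp [h0] at h11)
  have h21 : p.2.1.1 = 0 := by
    simp only [bil, h1, h2] at h6
    exact (mul_eq_zero.1 (by linarith : a * p.1.1 * p.2.1.1 = 0)).resolve_left hne
  have h31 : p.2.2.1 = 0 := by
    simp only [bil, h1, h2] at h5
    exact (mul_eq_zero.1 (by linarith : a * p.1.1 * p.2.2.1 = 0)).resolve_left hne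
  have box' : ∀ v : ℤ × ℤ × ℤ, bil a (k * 2) (k * 2) (-k) 0 0 v v = k * 2 →
      (-1 ≤ v.2.1 ∧ v.2.1 ≤ 1) ∧ -1 ≤ v.2.2 ∧ v.2.2 ≤ 1 := by
    intro v hv
    have hlt : bil a (k * 2) (k * 2) (-k) 0 0 v v < 2 * (k * 2) := by linarith
    exact ⟨abs_le.1 (h.abs_second_le ha hlt), abs_le.1 (h.abs_third_le ha hlt)⟩
  have b2 := box' _ hp.2.1
  have b3 := box' _ hp.2.2.1
  rw [mem_boxAuts, mem_box, mem_box, mem_box]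
  exact ⟨by omega, (key ⟨h11, h21, h31⟩).1 hp⟩

/-- The body-centred cubic lattice stretched orthogonally to one of its minimal vectors. Up to a
factor, both this form and the one for the cubic lattice are linear combinations of the square of
the product with `e₁` and of `y² - y z + z²`, and automorphs that preserve `e₁` up to sign preserve
both of these. -/
theorem natCard_bcc_stretched {m d : ℤ} (hm : 0 < m) (hd : 0 < d)
    (h : IsEisensteinReduced (m * 3) (m * 3 + d * 2) (m * 3 + d * 2) (-m - d) (-m) (-m)) :
    Nat.card (AutPlus (form (m * 3) (m * 3 + d * 2) (m * 3 + d * 2) (-m - d) (-m) (-m))) = 6 := by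
  rw [natCard_autPlus ((boxAuts 3 3 3 (-1) (-1) (-1)).filter fun p => p.1.2.1 = 0 ∧ p.1.2.2 = 0)]
  · decide +kernel
  intro p
  rw [Finset.mem_filter, ← isEisensteinReduced_bcc.isAut_iff_mem_boxAuts three_pos]
  let L : ℤ × ℤ × ℤ → ℤ := fun v => 3 * v.1 - v.2.1 - v.2.2
  let H : ℤ × ℤ × ℤ → ℤ × ℤ × ℤ → ℤ := fun u v =>
    2 * (u.2.1 * v.2.1 + u.2.2 * v.2.2) - (u.2.1 * v.2.2 + u.2.2 * v.2.1)
  have e : ∀ u v, 3 * bil (m * 3) (m * 3 + d * 2) (m * 3 + d * 2) (-m - d) (-m) (-m) u v =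
      m * (L u * L v) + (4 * m + 3 * d) * H u v := fun u v => by
    simp only [bil, L, H]
    ring
  have e' : ∀ u v, 3 * bil 3 3 3 (-1) (-1) (-1) u v = L u * L v + 4 * H u v := fun u v => by
    simp only [bil, L, H]
    ring
  have hmd : 4 * m + 3 * d ≠ 0 := by positivity
  have key : p.1.2.1 = 0 → p.1.2.2 = 0 → p.1.1 * p.1.1 = 1 → L p.2.1 = -p.1.1 → L p.2.2 = -p.1.1 →
      (IsAut (m * 3) (m * 3 + d * 2) (m * 3 + d * 2) (-m - d) (-m) (-m) p ↔
        IsAut 3 3 3 (-1) (-1) (-1) p) := by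
    intro h1 h2 h3 h4 h5
    have hL : L p.1 = 3 * p.1.1 := by simp only [L, h1, h2]; ring
    have l22 : L p.2.1 * L p.2.1 = 1 := by rw [h4]; linarith
    have l33 : L p.2.2 * L p.2.2 = 1 := by rw [h5]; linarith
    have l23 : L p.2.1 * L p.2.2 = 1 := by rw [h4, h5]; linarith
    -- Either condition on a product of columns amounts to the value `k` of `H` on them.
    have hH : ∀ {u v : ℤ × ℤ × ℤ} (n k : ℤ), L u * L v + 4 * k = 3 * n →
        (bil (m * 3) (m * 3 + d * 2) (m * 3 + d * 2) (-m - d) (-m) (-m) u v = m * n + d * k ↔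
          bil 3 3 3 (-1) (-1) (-1) u v = n) := by
      intro u v n k hl
      have e1 := e u v
      have e2 := e' u v
      constructor
      · intro hq
        have : H u v = k := mul_left_cancel₀ hmd (by linear_combination 3 * hq - e1 - m * hl)
        linarith
      · intro hq
        have : H u v = k := by linarith
        rw [this] at e1
        exact mul_left_cancel₀ three_ne_zero (by linear_combination e1 + m * hl)
    have c1 := hH (u := p.1) (v := p.1) 3 0 (by rw [hL]; linarith)
    have c2 := hH (u := p.2.1) (v := p.2.1) 3 2 (by rw [l22]; rfl)
    have c3 := hH (u := p.2.2) (v := p.2.2) 3 2 (by rw [l33]; rfl)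
    have c4 := hH (u := p.2.1) (v := p.2.2) (-1) (-1) (by rw [l23]; rfl)
    have c5 := hH (u := p.1) (v := p.2.2) (-1) 0 (by rw [hL, h5]; linarith)
    have c6 := hH (u := p.1) (v := p.2.1) (-1) 0 (by rw [hL, h4]; linarith)
    rw [mul_zero, add_zero] at c1 c5 c6
    rw [mul_neg_one] at c4 c5 c6
    rw [mul_neg_one, ← sub_eq_add_neg] at c4
    rw [IsAut, IsAut, c1, c2, c3, c4, c5, c6]
  have hLe : ∀ {x l : ℤ}, x * x = 1 → x * l = -1 → l = -x := fun {x l} h1 h2 => by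
    linear_combination x * h2 - l * h1
  constructor
  · intro hp
    obtain ⟨h1, h2, h3⟩ := h.isAut_first (by omega) (by omega) hp
    have hx : p.1.1 * p.1.1 = 1 := mul_self_eq_one_iff.2 h3
    have h5 := hp.2.2.2.2.1
    have h6 := hp.2.2.2.2.2.1
    simp only [bil, h1, h2] at h5 h6
    have l2 : L p.2.1 = -p.1.1 := hLe hx (mul_left_cancel₀ hm.ne' (by simp only [L]; linarith))
    have l3 : L p.2.2 = -p.1.1 := hLe hx (mul_left_cancel₀ hm.ne' (by simp only [L]; linarith))
    exact ⟨(key h1 h2 hx l2 l3).1 hp, h1, h2⟩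
  · rintro ⟨hp, h1, h2⟩
    have h3 := hp.1
    have h5 := hp.2.2.2.2.1
    have h6 := hp.2.2.2.2.2.1
    simp only [bil, h1, h2] at h3 h5 h6
    have hx : p.1.1 * p.1.1 = 1 := by linarith
    exact (key h1 h2 hx (hLe hx (by simp only [L]; linarith))
      (hLe hx (by simp only [L]; linarith))).2 hp

/-- Distinct columns of an invertible matrix with unit vectors as columns are orthogonal. -/
theorem bil_cubic_eq_zero :
    ∀ u ∈ box.filter fun v => bil 1 1 1 0 0 0 v v = 1,
    ∀ v ∈ box.filter fun v => bil 1 1 1 0 0 0 v v = 1,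
    ∀ w ∈ box.filter fun v => bil 1 1 1 0 0 0 v v = 1, detCols u v w = 1 →
      bil 1 1 1 0 0 0 v w = 0 ∧ bil 1 1 1 0 0 0 u w = 0 ∧ bil 1 1 1 0 0 0 u v = 0 := by
  decide +kernel

/-- If the three axes are equivalent but not orthogonal, and there are no minimal vectors other
than `±e₁`, `±e₂`, `±e₃`, then automorphs are signed permutations of the axes that preserve
`x y + x z + y z` as well. -/
theorem natCard_rhombohedral {a m : ℤ} (hm : m ≠ 0) (h1 : 2 * m < a) (h2 : -a < 3 * m)
    (h : IsEisensteinReduced a a a m m m) :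
    Nat.card (AutPlus (form a a a m m m)) = 6 := by
  rw [natCard_autPlus ((boxAuts 3 3 3 1 1 1))]
  · decide +kernel
  intro p
  have ha : 0 < a := by omega
  have e : ∀ u v, bil a a a m m m u v =
      (a - 3 * m) * bil 1 1 1 0 0 0 u v + m * bil 3 3 3 1 1 1 u v :=
    fun u v => by unfold bil; ring
  have hunit : ∀ v, bil a a a m m m v v = a → v ∈ box.filter fun v => bil 1 1 1 0 0 0 v v = 1 := by
    rintro ⟨x, y, z⟩ hq
    have hv := h.mem_box_of_bil_eq ha hq
    refine Finset.mem_filter.2 ⟨hv, ?_⟩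
    obtain ⟨⟨x1, x2⟩, ⟨y1, y2⟩, z1, z2⟩ := mem_box.1 hv
    dsimp only at x1 x2 y1 y2 z1 z2
    interval_cases x <;> interval_cases y <;> interval_cases z <;> simp [bil] at hq ⊢ <;> omega
  have key : IsAut 1 1 1 0 0 0 p → (IsAut a a a m m m p ↔ IsAut 3 3 3 1 1 1 p) := by
    rintro ⟨k1, k2, k3, k4, k5, k6, k7⟩
    have e1 : ∀ x, a - 3 * m + m * x = a ↔ x = 3 := fun x =>
      ⟨fun h => mul_left_cancel₀ hm (by linarith), fun h => by rw [h]; ring⟩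
    have e2 : ∀ x, m * x = m ↔ x = 1 := fun x => mul_eq_left₀ hm
    simp only [IsAut, e, k1, k2, k3, k4, k5, k6, mul_one, mul_zero, zero_add, e1, e2]
  have hsub : ∀ p ∈ boxAuts 3 3 3 1 1 1, p ∈ boxAuts 1 1 1 0 0 0 := by decide +kernel
  constructor
  · intro hp
    have u1 := hunit _ hp.1
    have u2 := hunit _ hp.2.1
    have u3 := hunit _ hp.2.2.1
    have h0 := bil_cubic_eq_zero _ u1 _ u2 _ u3 hp.2.2.2.2.2.2
    rw [Finset.mem_filter] at u1 u2 u3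
    exact mem_boxAuts.2 ⟨⟨u1.1, u2.1, u3.1⟩, (key ⟨u1.2, u2.2, u3.2, h0.1, h0.2.1, h0.2.2,
      hp.2.2.2.2.2.2⟩).1 hp⟩
  · intro hp
    exact (key (mem_boxAuts.1 (hsub p hp)).2).2 (mem_boxAuts.1 hp).2

/-! ### Forms with distinct minima -/

/-- The unimodular `2 × 2` matrices of order `1` or `3` with entries in `{-1, 0, 1}`. -/
theorem two_by_two_of_cube_eq_one : ∀ x ∈ Finset.Icc (-1 : ℤ) 1, ∀ y ∈ Finset.Icc (-1 : ℤ) 1,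
    ∀ z ∈ Finset.Icc (-1 : ℤ) 1, ∀ w ∈ Finset.Icc (-1 : ℤ) 1,
    (x * w - y * z = 1 ∧ x * (x * x + y * z) + y * (z * x + w * z) = 1 ∧
      x * (x * y + y * w) + y * (z * y + w * w) = 0 ∧
      z * (x * x + y * z) + w * (z * x + w * z) = 0) →
    (x = 1 ∧ y = 0 ∧ z = 0 ∧ w = 1) ∨ (x = 0 ∧ y = 1 ∧ z = -1 ∧ w = -1) ∨
      (x = 0 ∧ y = -1 ∧ z = 1 ∧ w = -1) ∨ (x = -1 ∧ y = 1 ∧ z = -1 ∧ w = 0) ∨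
      (x = -1 ∧ y = -1 ∧ z = 1 ∧ w = 0) := by
  decide +kernel

theorem not_isOrderThree_of_unipotent {x y z : ℤ} :
    ¬ IsOrderThree ((1, 0, 0), (x, 1, 0), (y, z, 1)) := by
  rintro ⟨hne, h⟩
  simp [app] at h hne
  have hx : x = 0 := by omega
  have hz : z = 0 := by omega
  subst hx hz
  omega

theorem eq_one_of_cube_eq_one {x : ℤ} (h : x = 1 ∨ x = -1) (h3 : x * (x * x) = 1) : x = 1 := by
  rcases h with rfl | rfl
  · rfl
  · norm_num at h3

/-- With three distinct minima, an automorph of order `3` would be unipotent. -/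
theorem IsEisensteinReduced.not_isOrderThree_of_lt_of_lt (h : IsEisensteinReduced a b c r s t)
    (ha : 0 < a) (hab : a < b) (hbc : b < c)
    {p : (ℤ × ℤ × ℤ) × (ℤ × ℤ × ℤ) × (ℤ × ℤ × ℤ)} (hp : IsAut a b c r s t p) :
    ¬ IsOrderThree p := by
  intro h3
  obtain ⟨k1, k2, k3⟩ := h.isAut_first ha hab hp
  obtain ⟨-, k4, k5⟩ := h.isAut_third ha hbc hp
  obtain ⟨⟨x1, y1, z1⟩, ⟨x2, y2, z2⟩, x3, y3, z3⟩ := p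
  dsimp only at k1 k2 k3 k4 k5
  subst k1 k2 k4
  have h3' := h3.2
  simp only [app, Prod.mk.injEq] at h3'
  have e1 : x1 = 1 := eq_one_of_cube_eq_one k3 (by linarith [h3'.1.1])
  have e3 : z3 = 1 := eq_one_of_cube_eq_one (mul_self_eq_one_iff.1 k5) (by linarith [h3'.2.2.2.2])
  subst e1 e3
  have hd := hp.2.2.2.2.2.2
  simp only [detCols] at hd
  have e2 : y2 = 1 := by linarith
  subst e2
  exact not_isOrderThree_of_unipotent h3

/-- The case of one short vector: the automorph fixes `e₁`, and acts with order `3` on the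
quotient by it. -/
theorem IsEisensteinReduced.eq_of_isOrderThree_of_lt (h : IsEisensteinReduced a b b r s t)
    (ha : 0 < a) (hab : a < b)
    {p : (ℤ × ℤ × ℤ) × (ℤ × ℤ × ℤ) × (ℤ × ℤ × ℤ)} (hp : IsAut a b b r s t p)
    (h3 : IsOrderThree p) :
    (s = t ∧ 2 * r + s = -b ∧ a = -3 * s) ∨ (b = -2 * r ∧ s = 0 ∧ t = 0) := by
  obtain ⟨k1, k2, k3⟩ := h.isAut_first ha hab hp
  have b2 := abs_le.1 (h.abs_second_le ha (v := p.2.1) (by linarith [hp.2.1]))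
  have b2' := abs_le.1 (h.abs_third_le ha (v := p.2.1) (by linarith [hp.2.1]))
  have b3 := abs_le.1 (h.abs_second_le ha (v := p.2.2) (by linarith [hp.2.2.1]))
  have b3' := abs_le.1 (h.abs_third_le ha (v := p.2.2) (by linarith [hp.2.2.1]))
  obtain ⟨⟨x1, y1, z1⟩, ⟨x2, y2, z2⟩, x3, y3, z3⟩ := p
  dsimp only at k1 k2 k3 b2 b2' b3 b3'
  subst k1 k2
  have h3' := h3.2
  simp only [app, Prod.mk.injEq] at h3'
  have e1 : x1 = 1 := eq_one_of_cube_eq_one k3 (by linarith [h3'.1.1])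
  subst e1
  obtain ⟨-, q2, q3, q23, q13, q12, hd⟩ := hp
  simp only [bil, detCols] at q2 q3 q23 q13 q12 hd
  obtain ⟨hsign, -, -, he, hs, ht, hr, -, h1, h2, h4, h5, h6, h7, h8, h9⟩ := h
  have h1 := h1 rfl
  rw [abs_le] at hs ht hr
  rcases two_by_two_of_cube_eq_one y2 (Finset.mem_Icc.2 b2) y3 (Finset.mem_Icc.2 b3)
    z2 (Finset.mem_Icc.2 b2') z3 (Finset.mem_Icc.2 b3') ⟨by linarith, by linarith [h3'.2.1.2.1],
      by linarith [h3'.2.2.2.1], by linarith [h3'.2.1.2.2]⟩ with h | h | h | h | h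
  · obtain ⟨rfl, rfl, rfl, rfl⟩ := h
    exact (not_isOrderThree_of_unipotent h3).elim
  all_goals
    obtain ⟨rfl, rfl, rfl, rfl⟩ := h
    -- The products with `e₁` bound the first coordinates.
    have l2 : -2 < x2 := lt_of_mul_lt_mul_left (by linarith : a * -2 < a * x2) ha.le
    have u2 : x2 < 2 := lt_of_mul_lt_mul_left (by linarith : a * x2 < a * 2) ha.le
    have l3 : -2 < x3 := lt_of_mul_lt_mul_left (by linarith : a * -2 < a * x3) ha.le
    have u3 : x3 < 2 := lt_of_mul_lt_mul_left (by linarith : a * x3 < a * 2) ha.le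
    clear h3 h3' k3 b2 b2' b3 b3' hd
    interval_cases x2 <;> interval_cases x3 <;> ring_nf at q2 q3 q23 q13 q12 <;> grind

/-- The case of two short vectors: the automorph preserves their plane, on which it has order `3`,
so that the plane is hexagonal, and it translates `e₃` by a vector of the plane. -/
theorem IsEisensteinReduced.eq_of_isOrderThree_of_lt_c (h : IsEisensteinReduced a a c r s t)
    (ha : 0 < a) (hac : a < c)
    {p : (ℤ × ℤ × ℤ) × (ℤ × ℤ × ℤ) × (ℤ × ℤ × ℤ)} (hp : IsAut a a c r s t p)
    (h3 : IsOrderThree p) :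
    (a = 2 * r ∧ a = 2 * s ∧ a = 2 * t) ∨ (a = -2 * t ∧ r = 0 ∧ s = 0) := by
  obtain ⟨k1, k2, k3⟩ := h.isAut_third ha hac hp
  have b1 := abs_le.1 (h.abs_first_le ha (v := p.1) (by linarith [hp.1]))
  have b1' := abs_le.1 (h.abs_second_le ha (v := p.1) (by linarith [hp.1]))
  have b2 := abs_le.1 (h.abs_first_le ha (v := p.2.1) (by linarith [hp.2.1]))
  have b2' := abs_le.1 (h.abs_second_le ha (v := p.2.1) (by linarith [hp.2.1]))
  obtain ⟨⟨x1, y1, z1⟩, ⟨x2, y2, z2⟩, x3, y3, z3⟩ := p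
  dsimp only at k1 k2 k3 b1 b1' b2 b2'
  subst k1 k2
  have h3' := h3.2
  simp only [app, Prod.mk.injEq] at h3'
  have e1 : z3 = 1 := eq_one_of_cube_eq_one (mul_self_eq_one_iff.1 k3) (by linarith [h3'.2.2.2.2])
  subst e1
  obtain ⟨q1, q2, q3, q23, q13, q12, hd⟩ := hp
  simp only [bil, detCols] at q1 q2 q3 q23 q13 q12 hd
  obtain ⟨hsign, -, -, he, hs, ht, hr, h1, -, h2, h4, h5, h6, h7, h8, h9⟩ := h
  have h1 := h1 rfl
  rw [abs_le] at hs ht hr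
  rcases two_by_two_of_cube_eq_one x1 (Finset.mem_Icc.2 b1) x2 (Finset.mem_Icc.2 b2)
    y1 (Finset.mem_Icc.2 b1') y2 (Finset.mem_Icc.2 b2') ⟨by linarith, by linarith [h3'.1.1],
      by linarith [h3'.2.1.1], by linarith [h3'.1.2.1]⟩ with h | h | h | h | h
  · obtain ⟨rfl, rfl, rfl, rfl⟩ := h
    simp [app, IsOrderThree] at h3
    omega
  all_goals
    obtain ⟨rfl, rfl, rfl, rfl⟩ := h
    clear h3 h3' b1 b1' b2 b2' hd
    -- The products among the first two columns show that the plane is hexagonal.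
    have hat : a = 2 * t ∨ a = -2 * t := by
      first
      | exact Or.inl (by linarith)
      | exact Or.inr (by linarith)
    -- The equations `q13` and `q23` are linear in the translation `(x3, y3)`, and bound it.
    rcases hat with rfl | rfl
    · have l2 : -3 < x3 := lt_of_mul_lt_mul_left (by linarith : t * -3 < t * x3) (by linarith)
      have u2 : x3 < 3 := lt_of_mul_lt_mul_left (by linarith : t * x3 < t * 3) (by linarith)
      have l3 : -3 < y3 := lt_of_mul_lt_mul_left (by linarith : t * -3 < t * y3) (by linarith)
      have u3 : y3 < 3 := lt_of_mul_lt_mul_left (by linarith : t * y3 < t * 3) (by linarith)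
      clear k3 q3
      interval_cases x3 <;> interval_cases y3 <;> ring_nf at q23 q13 <;> omega
    · have hs0 := h4 rfl
      have l2 : -3 < x3 := lt_of_mul_lt_mul_left (by linarith : -t * -3 < -t * x3) (by linarith)
      have u2 : x3 < 3 := lt_of_mul_lt_mul_left (by linarith : -t * x3 < -t * 3) (by linarith)
      have l3 : -3 < y3 := lt_of_mul_lt_mul_left (by linarith : -t * -3 < -t * y3) (by linarith)
      have u3 : y3 < 3 := lt_of_mul_lt_mul_left (by linarith : -t * y3 < -t * 3) (by linarith)
      clear k3 q3
      interval_cases x3 <;> interval_cases y3 <;> ring_nf at q23 q13 <;> omega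

/-! ### Forms with equal minima, and the classification -/

/-- The matrices of order `3` that permute the axes cyclically, up to signs. -/
def signedCycles : Finset ((ℤ × ℤ × ℤ) × (ℤ × ℤ × ℤ) × (ℤ × ℤ × ℤ)) :=
  {((0, 1, 0), (0, 0, 1), (1, 0, 0)), ((0, 1, 0), (0, 0, -1), (-1, 0, 0)),
    ((0, -1, 0), (0, 0, 1), (-1, 0, 0)), ((0, -1, 0), (0, 0, -1), (1, 0, 0)),
    ((0, 0, 1), (1, 0, 0), (0, 1, 0)), ((0, 0, 1), (-1, 0, 0), (0, -1, 0)),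
    ((0, 0, -1), (1, 0, 0), (0, -1, 0)), ((0, 0, -1), (-1, 0, 0), (0, 1, 0))}

/-- The other matrices of order `3` that permute `e₁, e₂, e₃, -(e₁ + e₂ + e₃)`. -/
def obtuseCycles : Finset ((ℤ × ℤ × ℤ) × (ℤ × ℤ × ℤ) × (ℤ × ℤ × ℤ)) :=
  {((1, 0, 0), (0, 0, 1), (-1, -1, -1)), ((1, 0, 0), (-1, -1, -1), (0, 1, 0)),
    ((0, 1, 0), (-1, -1, -1), (0, 0, 1)), ((0, 0, 1), (0, 1, 0), (-1, -1, -1)),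
    ((-1, -1, -1), (1, 0, 0), (0, 0, 1)), ((-1, -1, -1), (0, 1, 0), (1, 0, 0))}

/-- The other matrices of order `3` with columns among the vectors `±eᵢ`, `±(e₁ - e₂)` and
`±(e₁ - e₃)`. -/
def acuteCycles : Finset ((ℤ × ℤ × ℤ) × (ℤ × ℤ × ℤ) × (ℤ × ℤ × ℤ)) :=
  {((0, 1, 0), (1, 0, -1), (-1, 1, 0)), ((0, -1, 0), (1, -1, 0), (0, 0, 1)),
    ((0, -1, 0), (1, -1, 0), (-1, 0, 1)), ((0, -1, 0), (1, 0, -1), (1, -1, 0)),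
    ((0, 0, 1), (-1, 0, 1), (1, -1, 0)), ((0, 0, -1), (0, 1, 0), (1, 0, -1)),
    ((0, 0, -1), (-1, 1, 0), (1, 0, -1)), ((0, 0, -1), (1, 0, -1), (1, -1, 0)),
    ((-1, 1, 0), (-1, 0, 0), (0, 0, 1)), ((-1, 1, 0), (-1, 0, 0), (-1, 0, 1)),
    ((-1, 1, 0), (-1, 0, 1), (0, 0, 1)), ((-1, 0, 1), (0, 1, 0), (-1, 0, 0)),
    ((-1, 0, 1), (0, 1, 0), (-1, 1, 0)), ((-1, 0, 1), (-1, 1, 0), (-1, 0, 0))}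

/-- The vectors `±eᵢ` and `±(e₁ + e₂ + e₃)`. -/
def obtuseVecs : Finset (ℤ × ℤ × ℤ) :=
  {(1, 0, 0), (-1, 0, 0), (0, 1, 0), (0, -1, 0), (0, 0, 1), (0, 0, -1), (1, 1, 1), (-1, -1, -1)}

/-- The vectors `±eᵢ`, `±(e₁ - e₂)` and `±(e₁ - e₃)`. -/
def acuteVecs : Finset (ℤ × ℤ × ℤ) :=
  {(1, 0, 0), (-1, 0, 0), (0, 1, 0), (0, -1, 0), (0, 0, 1), (0, 0, -1), (1, -1, 0), (-1, 1, 0),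
    (1, 0, -1), (-1, 0, 1)}

theorem mem_of_obtuseVecs : ∀ u ∈ obtuseVecs, ∀ v ∈ obtuseVecs, ∀ w ∈ obtuseVecs,
    IsOrderThree (u, v, w) → (u, v, w) ∈ signedCycles ∪ obtuseCycles := by
  decide +kernel

theorem mem_of_acuteVecs : ∀ u ∈ acuteVecs, ∀ v ∈ acuteVecs, ∀ w ∈ acuteVecs,
    IsOrderThree (u, v, w) → (u, v, w) ∈ signedCycles ∪ acuteCycles := by
  decide +kernel

theorem eq_of_mem_signedCycles
    (hsign : (0 < r ∧ 0 < s ∧ 0 < t) ∨ (r ≤ 0 ∧ s ≤ 0 ∧ t ≤ 0))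
    {p : (ℤ × ℤ × ℤ) × (ℤ × ℤ × ℤ) × (ℤ × ℤ × ℤ)} (hp : IsAut a b c r s t p)
    (h : p ∈ signedCycles) : r = s ∧ s = t := by
  simp only [signedCycles, Finset.mem_insert, Finset.mem_singleton] at h
  rcases h with rfl | rfl | rfl | rfl | rfl | rfl | rfl | rfl <;>
    simp [IsAut, bil] at hp <;> omega

/-- The case of three equal minima: the columns of the automorph are among the few minimal vectors,
and most of the matrices of order `3` made of these are incompatible with the tie-breaking
conditions of Eisenstein reduction. -/
theorem IsEisensteinReduced.eq_of_isOrderThree_of_eq (h : IsEisensteinReduced a a a r s t)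
    (ha : 0 < a) {p : (ℤ × ℤ × ℤ) × (ℤ × ℤ × ℤ) × (ℤ × ℤ × ℤ)} (hp : IsAut a a a r s t p)
    (h3 : IsOrderThree p) : (r = s ∧ s = t) ∨ (a = -2 * t ∧ r = 0 ∧ s = 0) := by
  obtain ⟨u, v, w⟩ := p
  have hbox := fun v => h.mem_box_of_bil_eq ha (v := v)
  obtain ⟨hsign, -, -, he, hs, ht, hr, h1, h1', h2, h4, h5, h6, h7, h8, h9⟩ := h
  have h1 := h1 rfl
  have h1' := h1' rfl
  rw [abs_le] at hs ht hr
  have hord : (0 < r ∧ r ≤ s ∧ s ≤ t) ∨ (t ≤ s ∧ s ≤ r ∧ r ≤ 0) := by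
    clear h2 h4 h5 h6 h7 h8 h9
    grind
  by_cases hneg : a = -2 * t
  · have := h4 hneg
    subst this
    exact Or.inr ⟨hneg, by simpa using h1, rfl⟩
  by_cases hfcc : a = 2 * r
  · left
    grind
  by_cases hpos : a = 2 * t
  · have hvec : ∀ v, bil a a a r s t v v = a → v ∈ acuteVecs := by
      rintro ⟨x, y, z⟩ hq
      obtain ⟨⟨x1, x2⟩, ⟨y1, y2⟩, z1, z2⟩ := mem_box.1 (hbox _ hq)
      dsimp only at x1 x2 y1 y2 z1 z2
      interval_cases x <;> interval_cases y <;> interval_cases z <;> simp [bil] at hq <;>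
        first | decide | omega
    have hmem := mem_of_acuteVecs _ (hvec _ hp.1) _ (hvec _ hp.2.1) _ (hvec _ hp.2.2.1) h3
    rcases Finset.mem_union.1 hmem with hm | hm
    · exact Or.inl (eq_of_mem_signedCycles hsign hp hm)
    · simp only [acuteCycles, Finset.mem_insert, Finset.mem_singleton] at hm
      rcases hm with hm | hm | hm | hm | hm | hm | hm | hm | hm | hm | hm | hm | hm | hm <;>
        (rw [hm] at hp; simp [IsAut, bil] at hp; omega)
  · have hvec : ∀ v, bil a a a r s t v v = a → v ∈ obtuseVecs := by
      rintro ⟨x, y, z⟩ hq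
      obtain ⟨⟨x1, x2⟩, ⟨y1, y2⟩, z1, z2⟩ := mem_box.1 (hbox _ hq)
      dsimp only at x1 x2 y1 y2 z1 z2
      interval_cases x <;> interval_cases y <;> interval_cases z <;> simp [bil] at hq <;>
        first | decide | omega
    have hmem := mem_of_obtuseVecs _ (hvec _ hp.1) _ (hvec _ hp.2.1) _ (hvec _ hp.2.2.1) h3
    rcases Finset.mem_union.1 hmem with hm | hm
    · exact Or.inl (eq_of_mem_signedCycles hsign hp hm)
    · simp only [obtuseCycles, Finset.mem_insert, Finset.mem_singleton] at hm
      rcases hm with hm | hm | hm | hm | hm | hm <;>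
        (rw [hm] at hp; simp [IsAut, bil] at hp; omega)

/-- The five families of reduced forms that have an automorph of order `3`. -/
theorem IsEisensteinReduced.eq_of_isOrderThree (h : IsEisensteinReduced a b c r s t)
    (ha : 0 < a) {p : (ℤ × ℤ × ℤ) × (ℤ × ℤ × ℤ) × (ℤ × ℤ × ℤ)} (hp : IsAut a b c r s t p)
    (h3 : IsOrderThree p) :
    (a = b ∧ b = c ∧ r = s ∧ s = t) ∨
      (a = b ∧ b < c ∧ a = 2 * r ∧ a = 2 * s ∧ a = 2 * t) ∨
      (a < b ∧ b = c ∧ s = t ∧ 2 * r + s = -b ∧ a = -3 * s) ∨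
      (a = b ∧ a = -2 * t ∧ r = 0 ∧ s = 0) ∨ (a < b ∧ b = c ∧ b = -2 * r ∧ s = 0 ∧ t = 0) := by
  rcases h.a_le_b.eq_or_lt with rfl | hab <;> rcases h.b_le_c.eq_or_lt with rfl | hbc
  · rcases h.eq_of_isOrderThree_of_eq ha hp h3 with h' | h'
    · exact Or.inl ⟨rfl, rfl, h'⟩
    · exact Or.inr (Or.inr (Or.inr (Or.inl ⟨rfl, h'⟩)))
  · rcases h.eq_of_isOrderThree_of_lt_c ha hbc hp h3 with h' | h'
    · exact Or.inr (Or.inl ⟨rfl, hbc, h'⟩)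
    · exact Or.inr (Or.inr (Or.inr (Or.inl ⟨rfl, h'⟩)))
  · rcases h.eq_of_isOrderThree_of_lt ha hab hp h3 with h' | h'
    · exact Or.inr (Or.inr (Or.inl ⟨hab, rfl, h'⟩))
    · exact Or.inr (Or.inr (Or.inr (Or.inr ⟨hab, rfl, h'⟩)))
  · exact (h.not_isOrderThree_of_lt_of_lt ha hab hbc hp h3).elim

/-- The forms with three equivalent axes: primitive, face-centred and body-centred cubic ones have
`24` automorphs of determinant `1`. -/
theorem natCard_autPlus_of_eq (h : IsEisensteinReduced a a a t t t) (ha : 0 < a) :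
    Nat.card (AutPlus (form a a a t t t)) =
      if t = 0 ∨ a = 2 * t ∨ a = -3 * t then 24 else 6 := by
  have h1 := (abs_le.1 h.two_t_le)
  have h2 := h.eps_nonneg
  by_cases h0 : t = 0
  · subst h0
    simpa using natCard_cubic ha
  by_cases hf : a = 2 * t
  · rw [if_pos (by tauto)]
    have := natCard_fcc (k := t) (by omega)
    rwa [mul_one, mul_comm, ← hf] at this
  by_cases hb : a = -3 * t
  · rw [if_pos (by tauto)]
    have := natCard_bcc (k := -t) (by omega)
    rwa [show -t * 3 = a by omega, show -t * -1 = t by ring] at this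
  · rw [if_neg (by tauto)]
    have := h.of_a_eq_neg_two_t
    exact natCard_rhombohedral h0 (by omega) (by omega) h

end TernaryForm

theorem theorem3p1 (a b c r s t : ℤ)
    (hpos : (TernaryForm.form a b c r s t).PosDef)
    (hred : TernaryForm.IsEisensteinReduced a b c r s t)
    (h3 : 3 ∣ Nat.card (TernaryForm.AutPlus (TernaryForm.form a b c r s t))) :
    (Nat.card (TernaryForm.AutPlus (TernaryForm.form a b c r s t)) = 6 ∨
      Nat.card (TernaryForm.AutPlus (TernaryForm.form a b c r s t)) = 12 ∨
      Nat.card (TernaryForm.AutPlus (TernaryForm.form a b c r s t)) = 24) ∧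
    (Nat.card (TernaryForm.AutPlus (TernaryForm.form a b c r s t)) = 6 ↔
      ((a = b ∧ b = c ∧ r = s ∧ s = t ∧ t ≠ 0 ∧
          (0 < r → a ≠ 2 * r) ∧ (r < 0 → a ≠ -3 * s ∧ a ≠ -2 * r)) ∨
        (a = b ∧ b = 2 * r ∧ b = 2 * s ∧ b = 2 * t ∧ b ≠ c) ∨
        (b = c ∧ s = t ∧ 2 * r + s = -b ∧ a = -3 * s ∧ a ≠ b))) ∧
    (Nat.card (TernaryForm.AutPlus (TernaryForm.form a b c r s t)) = 12 ↔
      ((a = b ∧ b = -2 * t ∧ r = 0 ∧ s = 0) ∨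
        (a ≠ b ∧ b = c ∧ c = -2 * r ∧ s = 0 ∧ t = 0))) ∧
    (Nat.card (TernaryForm.AutPlus (TernaryForm.form a b c r s t)) = 24 ↔
      ((∃ κ : ℤ, (κ = 2 ∨ κ = -3) ∧
          a = b ∧ b = c ∧ c = κ * r ∧ c = κ * s ∧ c = κ * t) ∨
        (a = b ∧ b = c ∧ r = 0 ∧ s = 0 ∧ t = 0))) := by
  have ha := TernaryForm.a_pos_of_posDef hpos
  obtain ⟨p, hp, hp3⟩ := TernaryForm.exists_isOrderThree hpos hred h3
  have hκ : (∃ κ : ℤ, (κ = 2 ∨ κ = -3) ∧ a = b ∧ b = c ∧ c = κ * r ∧ c = κ * s ∧ c = κ * t) ↔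
      (a = b ∧ b = c ∧ c = 2 * r ∧ c = 2 * s ∧ c = 2 * t) ∨
        (a = b ∧ b = c ∧ c = -3 * r ∧ c = -3 * s ∧ c = -3 * t) := by
    simp only [or_and_right, exists_or, exists_eq_left]
  rw [hκ]
  have h2t := hred.of_a_eq_neg_two_t
  have key := hred.eq_of_isOrderThree ha hp hp3
  clear hp hp3 p h3 hκ hpos
  rcases key with ⟨rfl, rfl, rfl, rfl⟩ | ⟨rfl, hbc, hr, hs, ht⟩ | ⟨hab, rfl, rfl, hr, hs⟩ |
    ⟨rfl, ht, rfl, rfl⟩ | ⟨hab, rfl, hr, rfl, rfl⟩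
  · rw [TernaryForm.natCard_autPlus_of_eq hred ha]
    split_ifs <;> omega
  · obtain rfl : r = t := by omega
    obtain rfl : s = r := by omega
    obtain rfl : a = s * 2 := by omega
    obtain ⟨d, rfl⟩ : ∃ d, c = s * 2 + d := ⟨c - s * 2, by ring⟩
    rw [TernaryForm.natCard_fcc_stretched (by omega) (by omega) hred]
    omega
  · obtain ⟨m, rfl⟩ : ∃ m, s = -m := ⟨-s, by ring⟩
    obtain ⟨d, rfl⟩ : ∃ d, r = -m - d := ⟨-m - r, by ring⟩
    obtain rfl : a = m * 3 := by omega
    obtain rfl : b = m * 3 + d * 2 := by omega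
    rw [TernaryForm.natCard_bcc_stretched (by omega) (by omega) hred]
    omega
  · obtain ⟨k, rfl⟩ : ∃ k, t = -k := ⟨-t, by ring⟩
    obtain rfl : a = k * 2 := by omega
    obtain ⟨d, rfl⟩ : ∃ d, c = k * 2 + d := ⟨c - k * 2, by ring⟩
    have := hred.b_le_c
    rw [TernaryForm.natCard_hex_third (by omega) (by omega) hred]
    omega
  · obtain ⟨k, rfl⟩ : ∃ k, r = -k := ⟨-r, by ring⟩
    obtain rfl : b = k * 2 := by omega
    rw [TernaryForm.natCard_hex_first ha hab hred]
    omega
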